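/- All groups are finite. A group $G$ is a Camina group if the conjugacy class of $g$ is the coset $gG'$ for every $g \in G \setminus G'$, where $G' = [G,G]$. A finite group is a VZ-group if every irreducible complex character $\chi$ of it with $\chi(1) \neq 1$ vanishes off the center of the group. Let $p$ be a prime and let $G$ be a finite $p$-group that is a Camina group and has nilpotence class $3$. Write $G_3 = [G', G]$ and $C = C_G(G')$, and suppose that $C > G'$. Then: 1. $C' = G_3$ and $Z(C) = G'$; 2. $C$ is a VZ-group; 3. $|G_3| \le |G' : G_3|^{1/2}$. -/

import Mathlib

open scoped Pointwise

/-- A Camina group: the conjugacy class of `g` is the coset `gG'` for every `g ∈ G \ G'`. -/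
def IsCaminaGroup (G : Type*) [Group G] : Prop :=
  ∀ g : G, g ∉ commutator G → conjugatesOf g = g • (commutator G : Set G)

/-- `χ` is an irreducible complex character of `H`: the character of an irreducible
representation on `ℂⁿ` for some `n`. -/
def IsIrreducibleCharacter {H : Type*} [Group H] (χ : H → ℂ) : Prop :=
  ∃ (n : ℕ) (ρ : Representation ℂ H (Fin n → ℂ)), ρ.IsIrreducible ∧ χ = ρ.character

/-- A VZ-group: every nonlinear (that is, of degree `χ 1 ≠ 1`) irreducible complex character
vanishes off the center. -/
def IsVZGroup (H : Type*) [Group H] : Prop :=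
  ∀ χ : H → ℂ, IsIrreducibleCharacter χ → χ 1 ≠ 1 →
    ∀ h : H, h ∉ Subgroup.center H → χ h = 0

/-- The third term `G_3 = [G', G]` of the lower central series. -/
def thirdTerm (G : Type*) [Group G] : Subgroup G :=
  ⁅commutator G, (⊤ : Subgroup G)⁆

open scoped commutatorElement IsMulCommutative

/-! Write G₃ = [G', G]. For a character λ of Z(G) nontrivial on G₃, let D be the centralizer of G'
modulo ker λ and Z the part of G' central modulo ker λ. Duality for the pairing G' × G → ℂˣ given by
λ([z, g]) yields |G : D| = |G' : Z|. For x ∈ D outside G', three subgroups and the Camina condition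
give D = C_G(x mod Z). Hence, for g ∉ D, the map x ↦ [x, g] mod Z on D has kernel inside G', and |D
: G'| ≤ |G' : Z|. Thus |G : G'| ≤ |G' : Z|² ≤ |G' : G₃|².

The reverse bound |G' : G₃|² ≤ |G : G'| comes from G/G₃, a class-two group in which each noncentral
class is a full coset of the derived subgroup. Its commutator form gives a linear system of
alternating matrices over 𝔽_p with all nonzero members invertible. The determinant of the generic
member is a square f², and Chevalley–Warning applied to f bounds the dimension of the system by half
the matrix size.

So equality holds throughout and Z = G₃. For x ∈ C \ G', every λ gives the same D = C_G(x mod G₃),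
so C is this subgroup and |C : G'| = |G' : G₃|. Noncentral classes of C are then cosets of C' = G₃.
Schur's lemma makes C a VZ-group, and the class-two bound applied to C gives |G₃|² ≤ |C : G'|. -/

/-! ### Alternating matrices and linear systems of them -/

/-- The determinant of an alternating matrix over a field is a square. -/
theorem isSquare_det_of_alternating {K : Type*} [Field K] :
    ∀ (n : ℕ) (A : Matrix (Fin n) (Fin n) K), (∀ i, A i i = 0) → (∀ i j, A i j = -A j i) →
      IsSquare A.det := by
  intro n
  induction n using Nat.strong_induction_on with
  | _ n ih =>
  intro A hd hs
  match n, ih, A, hd, hs with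
  | 0, _, A, _, _ => simp
  | 1, _, A, hd, _ => simp [hd]
  | m + 2, ih, A, hd, hs =>
    by_cases h0 : ∀ j, A 0 j = 0
    · rw [Matrix.det_eq_zero_of_row_eq_zero 0 h0]; exact IsSquare.zero
    push Not at h0
    obtain ⟨j, hj⟩ := h0
    have hj0 : j ≠ 0 := fun h => hj (h ▸ hd 0)
    -- Indices 0 and j are moved into the leading 2 × 2 block, which becomes invertible; its Schur
    -- complement is again alternating, of size m.
    let σ : Equiv.Perm (Fin (m + 2)) := Equiv.swap 1 j
    let e₀ : Fin 2 ⊕ Fin m ≃ Fin (m + 2) := finSumFinEquiv.trans (finCongr (by omega))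
    let e : Fin 2 ⊕ Fin m ≃ Fin (m + 2) := e₀.trans σ
    let M := A.submatrix e e
    have hM : M.det = A.det := Matrix.det_submatrix_equiv_self e A
    have hMd : ∀ i, M i i = 0 := fun i => hd _
    have hMs : ∀ i j, M i j = -M j i := fun i j => hs _ _
    have he0 : e (Sum.inl 0) = 0 := by
      have : e₀ (Sum.inl 0) = 0 := by ext; simp [e₀]
      rw [Equiv.trans_apply, this]
      exact Equiv.swap_apply_of_ne_of_ne (by simp) hj0.symm
    have he1 : e (Sum.inl 1) = j := by
      have : e₀ (Sum.inl 1) = 1 := by ext; simp [e₀]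
      rw [Equiv.trans_apply, this]
      exact Equiv.swap_apply_left _ _
    have ha : M (Sum.inl 0) (Sum.inl 1) ≠ 0 := by
      change A _ _ ≠ 0
      rwa [he0, he1]
    set a := M (Sum.inl 0) (Sum.inl 1) with ha_def
    have hP : M.toBlocks₁₁ = !![0, a; -a, 0] := by
      ext i k
      fin_cases i <;> fin_cases k
      · exact hMd _
      · rfl
      · exact hMs _ _
      · exact hMd _
    let P' : Matrix (Fin 2) (Fin 2) K := !![0, -a⁻¹; a⁻¹, 0]
    let _ : Invertible M.toBlocks₁₁ := ⟨P', by
      rw [hP]; ext i k; fin_cases i <;> fin_cases k <;> simp [P', Matrix.mul_apply, ha], by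
      rw [hP]; ext i k; fin_cases i <;> fin_cases k <;> simp [P', Matrix.mul_apply, ha]⟩
    have hinv : ⅟M.toBlocks₁₁ = P' := rfl
    have hdet := Matrix.det_fromBlocks₁₁ M.toBlocks₁₁ M.toBlocks₁₂ M.toBlocks₂₁ M.toBlocks₂₂
    rw [Matrix.fromBlocks_toBlocks, hM, hinv] at hdet
    rw [hdet]
    have hS : ∀ i k, (M.toBlocks₂₂ - M.toBlocks₂₁ * P' * M.toBlocks₁₂) i k =
        M (Sum.inr i) (Sum.inr k) - (M (Sum.inr i) (Sum.inl 1) * a⁻¹ * M (Sum.inl 0) (Sum.inr k)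
          - M (Sum.inr i) (Sum.inl 0) * a⁻¹ * M (Sum.inl 1) (Sum.inr k)) := by
      intro i k
      simp [Matrix.mul_apply, P', Fin.sum_univ_two, Matrix.toBlocks₂₂, Matrix.toBlocks₂₁,
        Matrix.toBlocks₁₂]
      ring
    refine IsSquare.mul ⟨a, ?_⟩ (ih m (by omega) _ ?_ ?_)
    · rw [hP]; simp [Matrix.det_fin_two]
    · intro i
      rw [hS, hMd, hMs (Sum.inr i) (Sum.inl 1), hMs (Sum.inr i) (Sum.inl 0)]
      ring
    · intro i k
      rw [hS, hS, hMs (Sum.inr i) (Sum.inr k), hMs (Sum.inr i) (Sum.inl 1),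
        hMs (Sum.inr i) (Sum.inl 0), hMs (Sum.inr k) (Sum.inl 1), hMs (Sum.inr k) (Sum.inl 0)]
      ring

/-- The determinant of an alternating matrix over an integrally closed domain is a square. -/
theorem isSquare_det_of_alternating_of_isIntegrallyClosed {R : Type*} [CommRing R] [IsDomain R]
    [IsIntegrallyClosed R] {n : ℕ} (A : Matrix (Fin n) (Fin n) R) (hd : ∀ i, A i i = 0)
    (hs : ∀ i j, A i j = -A j i) : IsSquare A.det := by
  let K := FractionRing R
  obtain ⟨f, hf⟩ := isSquare_det_of_alternating n (A.map (algebraMap R K))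
    (fun i => by simp [hd]) (fun i j => by simp [hs i j])
  have hf' : algebraMap R K A.det = f ^ 2 := by
    rw [sq, ← hf, RingHom.map_det]; rfl
  -- The root `f` lives in the fraction field, but its square is in `R`, so it is integral over `R`.
  obtain ⟨r, hr⟩ := IsIntegrallyClosed.exists_algebraMap_eq_of_isIntegral_pow (R := R) (x := f)
    (n := 2) (by norm_num) (hf' ▸ isIntegral_algebraMap)
  refine ⟨r, FaithfulSMul.algebraMap_injective R K ?_⟩
  rw [hf', map_mul, hr, sq]

/-- An `m`-dimensional linear system of alternating `d × d` matrices over a finite prime field all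
of whose nonzero members are invertible satisfies `2 * m ≤ d`. -/
theorem two_mul_le_of_forall_det_ne_zero {p : ℕ} [Fact p.Prime] {m d : ℕ} (hd0 : 0 < d)
    (A : Fin m → Matrix (Fin d) (Fin d) (ZMod p)) (hd : ∀ k i, A k i i = 0)
    (hs : ∀ k i j, A k i j = -A k j i)
    (hdet : ∀ c : Fin m → ZMod p, c ≠ 0 → (∑ k, c k • A k).det ≠ 0) : 2 * m ≤ d := by
  classical
  by_contra hlt
  push Not at hlt
  -- The generic member of the system: its entries are linear forms, so its determinant f² has
  -- degree at most d, and deg f < m once d < 2m.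
  let M : Matrix (Fin d) (Fin d) (MvPolynomial (Fin m) (ZMod p)) :=
    Matrix.of fun i j => ∑ k, MvPolynomial.C (A k i j) * MvPolynomial.X k
  obtain ⟨f, hf⟩ := isSquare_det_of_alternating_of_isIntegrallyClosed M
    (fun i => by simp [M, hd]) (fun i j => by
      simp only [M, Matrix.of_apply, ← Finset.sum_neg_distrib]
      exact Finset.sum_congr rfl fun k _ => by rw [hs k i j]; simp)
  have hM (i j) : (M i j).totalDegree ≤ 1 := by
    change (∑ k, MvPolynomial.C (A k i j) * MvPolynomial.X k).totalDegree ≤ 1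
    refine MvPolynomial.totalDegree_finsetSum_le fun k _ => ?_
    refine (MvPolynomial.totalDegree_mul _ _).trans ?_
    simp
  have hdeg : M.det.totalDegree ≤ d := by
    rw [Matrix.det_apply]
    refine MvPolynomial.totalDegree_finsetSum_le fun σ _ => ?_
    refine (MvPolynomial.totalDegree_smul_le _ _).trans ?_
    refine (MvPolynomial.totalDegree_finsetProd _ _).trans ?_
    refine (Finset.sum_le_sum fun i _ => hM _ _).trans ?_
    simp
  have hfdeg : f.totalDegree < Fintype.card (Fin m) := by
    rw [Fintype.card_fin]
    by_cases h0 : f = 0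
    · rw [h0, MvPolynomial.totalDegree_zero]; omega
    · rw [hf, MvPolynomial.totalDegree_mul_of_isDomain h0 h0] at hdeg
      omega
  have heval (c : Fin m → ZMod p) :
      MvPolynomial.eval c f * MvPolynomial.eval c f = (∑ k, c k • A k).det := by
    rw [← map_mul, ← hf, RingHom.map_det]
    congr 1
    ext i j
    simp [M, Matrix.sum_apply, mul_comm]
  -- Chevalley–Warning: p divides the number of zeros of f, yet the origin is the only one (it is a
  -- zero because d > 0).
  have hdvd := char_dvd_card_solutions p hfdeg
  have hone : Fintype.card {x : Fin m → ZMod p // MvPolynomial.eval x f = 0} = 1 := by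
    rw [Fintype.card_eq_one_iff]
    have : Nonempty (Fin d) := ⟨⟨0, hd0⟩⟩
    refine ⟨⟨0, ?_⟩, ?_⟩
    · have := heval 0
      simpa using this
    · rintro ⟨c, hc⟩
      rw [Subtype.mk.injEq]
      by_contra hne
      apply hdet c hne
      rw [← heval, hc, zero_mul]
  rw [hone] at hdvd
  exact (Fact.out : p.Prime).one_lt.ne' (Nat.dvd_one.mp hdvd)

/-! ### Alternating bihomomorphisms into abelian p-groups -/

/-- A nontrivial bihomomorphism `β` into a finite abelian `p`-group `W`, each of whose
partial maps `β x` is trivial or surjective, forces `W` to be elementary abelian. -/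
theorem pow_eq_one_of_bihom_surjective {p : ℕ} [Fact p.Prime] {C W : Type*} [Group C]
    [CommGroup W] [Finite W] (hW : IsPGroup p W) (β : C →* C →* W)
    (hsurj : ∀ x, β x ≠ 1 → Function.Surjective (β x)) (hne : β ≠ 1) (w : W) : w ^ p = 1 := by
  obtain ⟨x, hx⟩ : ∃ x, β x ≠ 1 := by
    by_contra! h
    exact hne (MonoidHom.ext h)
  -- Otherwise β(xᵖ) = β(x)ᵖ is onto, so the p-th power map on `W` is onto, hence injective, which
  -- forces the p-group `W` to be trivial.
  have hpow : β (x ^ p) = 1 := by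
    by_contra hxp
    have hs : Function.Surjective fun w : W => w ^ p := by
      intro w
      obtain ⟨y, hy⟩ := hsurj _ hxp w
      exact ⟨β x y, by simpa using hy⟩
    have hinj := Finite.injective_iff_surjective.mpr hs
    apply hx
    ext y
    rw [MonoidHom.one_apply]
    obtain ⟨k, hk⟩ := hW (β x y)
    have key : ∀ (k : ℕ) (w : W), w ^ p ^ k = 1 → w = 1 := by
      intro k
      induction k with
      | zero => intro w hw; simpa using hw
      | succ k ih =>
        intro w hw
        refine ih w (hinj ?_)
        simpa [← pow_mul, ← pow_succ] using hw
    exact key k _ hk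
  obtain ⟨y, rfl⟩ := hsurj x hx w
  have := DFunLike.congr_fun hpow y
  simpa using this

/-- Let `V`, `W` be finite vector spaces over a prime field and `(φ x, φ y) ↦ ev y (φ x)` an
alternating pairing on `V = φ(C)` with values in `W` that is surjective in the second variable
for every nonzero first argument. Then `|W| ^ 2 ≤ |V|`. -/
theorem card_sq_le_card_of_pairing {p : ℕ} [Fact p.Prime] {C V W : Type*} [AddCommGroup V]
    [Module (ZMod p) V] [Finite V] [Nontrivial V] [AddCommGroup W] [Module (ZMod p) W] [Finite W]
    (φ : C → V) (hφ : Function.Surjective φ) (ev : C → V →ₗ[ZMod p] W)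
    (halt : ∀ x, ev x (φ x) = 0) (hskew : ∀ x y, ev y (φ x) = -ev x (φ y))
    (hsurj : ∀ x, φ x ≠ 0 → ∀ w, ∃ y, ev y (φ x) = w) :
    Nat.card W ^ 2 ≤ Nat.card V := by
  rw [Module.natCard_eq_pow_finrank (K := ZMod p) (V := W),
    Module.natCard_eq_pow_finrank (K := ZMod p) (V := V), Nat.card_zmod, ← pow_mul, mul_comm]
  refine Nat.pow_le_pow_right (Fact.out : p.Prime).pos ?_
  let bW := Module.finBasis (ZMod p) W
  let bV := Module.finBasis (ZMod p) V
  choose x hx using fun i => hφ (bV i)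
  refine two_mul_le_of_forall_det_ne_zero Module.finrank_pos
    (fun k => Matrix.of fun i j => bW.coord k (ev (x j) (φ (x i)))) ?_ ?_ ?_
  · intro k i
    simp only [Matrix.of_apply, halt, map_zero]
  · intro k i j
    simp only [Matrix.of_apply]
    rw [hskew, map_neg]
  · intro c hc hdet
    -- A singular member is the pairing followed by a nonzero functional `l`; a kernel vector `u`
    -- makes `l` vanish on all values paired with `u`, that is, on `W`.
    let l : W →ₗ[ZMod p] ZMod p := ∑ k, c k • bW.coord k
    obtain ⟨v, hv, hvM⟩ := Matrix.exists_vecMul_eq_zero_iff.mpr hdet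
    let u : V := ∑ i, v i • bV i
    have hu : u ≠ 0 := fun h =>
      hv (funext (Fintype.linearIndependent_iff.mp bV.linearIndependent v h))
    obtain ⟨g, hg⟩ := hφ u
    have hgj (j) : l (ev (x j) (φ g)) = 0 := by
      have h1 := congrFun hvM j
      rw [hg]
      simp only [u, map_sum, map_smul, ← hx]
      simp only [Matrix.vecMul, dotProduct, Matrix.sum_apply, Matrix.smul_apply, Matrix.of_apply,
        Pi.zero_apply] at h1
      simpa only [l, LinearMap.sum_apply, LinearMap.smul_apply, smul_eq_mul] using h1
    -- The pairing is linear only in its `V` argument, so skewness first moves the basis vectors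
    -- there.
    have hzero : l ∘ₗ ev g = 0 := by
      refine bV.ext fun j => ?_
      rw [← hx, LinearMap.comp_apply, hskew, map_neg, hgj, neg_zero, LinearMap.zero_apply]
    have hgl (y : C) : l (ev y (φ g)) = 0 := by
      rw [hskew, map_neg, ← LinearMap.comp_apply, hzero, LinearMap.zero_apply, neg_zero]
    apply hc
    funext k
    obtain ⟨y, hy⟩ := hsurj g (hg ▸ hu) (bW k)
    have := hgl y
    rw [hy] at this
    simpa [l, LinearMap.sum_apply, Finsupp.single_apply] using this

/-- If `β` is a nontrivial alternating bihomomorphism into a finite abelian `p`-group `W` such that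
each `β x` is trivial or surjective, then `|W| ^ 2` is at most the index of the radical. -/
theorem card_sq_le_index_ker {p : ℕ} [Fact p.Prime] {C W : Type*} [Group C] [Finite C]
    [CommGroup W] [Finite W] (hW : IsPGroup p W) (β : C →* C →* W) (halt : ∀ x, β x x = 1)
    (hsurj : ∀ x, β x ≠ 1 → Function.Surjective (β x)) (hne : β ≠ 1) :
    Nat.card W ^ 2 ≤ β.ker.index := by
  have hexp := pow_eq_one_of_bihom_surjective hW β hsurj hne
  let _ : Module (ZMod p) (Additive W) := AddCommGroup.zmodModule hexp
  -- The quotient by the radical is realized as `β.range`, with evaluation as the pairing.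
  let _ : Module (ZMod p) (Additive β.range) := AddCommGroup.zmodModule (n := p) <| by
    intro f
    change (f.toMul) ^ p = 1
    ext y
    exact hexp _
  have : Finite β.range := Finite.of_surjective _ β.rangeRestrict_surjective
  have hnt : Nontrivial (Additive β.range) := by
    by_contra h0
    rw [not_nontrivial_iff_subsingleton] at h0
    refine hne (MonoidHom.ext fun x => ?_)
    exact congrArg Subtype.val (congrArg Additive.toMul
      (Subsingleton.elim (Additive.ofMul (β.rangeRestrict x)) (Additive.ofMul 1)))
  have hskew (x y : C) : β x y = (β y x)⁻¹ := by
    have h := halt (x * y)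
    simp only [map_mul, MonoidHom.mul_apply, halt, one_mul, mul_one] at h
    exact eq_inv_of_mul_eq_one_right h
  rw [Subgroup.index_ker]
  refine card_sq_le_card_of_pairing (p := p) (V := Additive β.range) (W := Additive W)
    (fun x => Additive.ofMul (β.rangeRestrict x))
    (fun v => ?_) (fun y => AddMonoidHom.toZModLinearMap p
      (((MonoidHom.eval y).comp β.range.subtype).toAdditive)) (fun x => ?_) (fun x y => ?_)
    fun x hx w => ?_
  · obtain ⟨x, hx⟩ := β.rangeRestrict_surjective v.toMul
    exact ⟨x, congrArg Additive.ofMul hx⟩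
  · exact congrArg Additive.ofMul (halt x)
  · exact congrArg Additive.ofMul (hskew x y)
  · obtain ⟨y, hy⟩ := hsurj x (fun h => hx (congrArg Additive.ofMul (Subtype.ext h))) w.toMul
    exact ⟨y, congrArg Additive.ofMul hy⟩

/-! ### Class-two groups with full commutator cosets -/

/-- The commutator map of a group of nilpotency class at most two, as a bihomomorphism into the
derived subgroup (regarded as a subgroup of the center). -/
def commutatorBihom {H : Type*} [Group H] (h2 : commutator H ≤ Subgroup.center H) :
    H →* H →* (commutator H).subgroupOf (Subgroup.center H) :=
  -- Sitting inside the center gives the target its commutative group structure.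
  MonoidHom.mk'
    (fun x => MonoidHom.mk'
      (fun y => ⟨⟨⁅x, y⁆, h2 (Subgroup.commutator_mem_commutator trivial trivial)⟩,
        Subgroup.commutator_mem_commutator trivial trivial⟩)
      fun y z => by
        refine Subtype.ext (Subtype.ext ?_)
        change ⁅x, y * z⁆ = ⁅x, y⁆ * ⁅x, z⁆
        have h : y * ⁅x, z⁆ = ⁅x, z⁆ * y :=
          Subgroup.mem_center_iff.mp (h2 (Subgroup.commutator_mem_commutator trivial trivial)) y
        rw [show ⁅x, y * z⁆ = ⁅x, y⁆ * (y * ⁅x, z⁆ * y⁻¹) by simp only [commutatorElement_def]; group,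
          h, mul_inv_cancel_right])
    fun x y => by
      ext z
      change ⁅x * y, z⁆ = ⁅x, z⁆ * ⁅y, z⁆
      have h : ∀ w, w * ⁅y, z⁆ = ⁅y, z⁆ * w :=
        Subgroup.mem_center_iff.mp (h2 (Subgroup.commutator_mem_commutator trivial trivial))
      rw [show ⁅x * y, z⁆ = (x * ⁅y, z⁆ * x⁻¹) * ⁅x, z⁆ by simp only [commutatorElement_def]; group,
        h x, mul_inv_cancel_right, h]

theorem coe_commutatorBihom_apply {H : Type*} [Group H] (h2 : commutator H ≤ Subgroup.center H)
    (x y : H) : ((commutatorBihom h2 x y : Subgroup.center H) : H) = ⁅x, y⁆ := rfl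

theorem commutatorBihom_apply_eq_one_iff {H : Type*} [Group H]
    (h2 : commutator H ≤ Subgroup.center H) (x : H) :
    commutatorBihom h2 x = 1 ↔ x ∈ Subgroup.center H := by
  rw [Subgroup.mem_center_iff]
  constructor
  · intro h y
    have h1 : ⁅x, y⁆ = 1 := by rw [← coe_commutatorBihom_apply h2, h]; rfl
    exact (commutatorElement_eq_one_iff_mul_comm.mp h1).symm
  · intro h
    ext y
    rw [coe_commutatorBihom_apply, commutatorElement_eq_one_iff_mul_comm.mpr (h y).symm]
    rfl

theorem card_subgroupOf_center {H : Type*} [Group H] (h2 : commutator H ≤ Subgroup.center H) :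
    Nat.card ((commutator H).subgroupOf (Subgroup.center H)) = Nat.card (commutator H) :=
  Nat.card_congr (Subgroup.subgroupOfEquivOfLe h2).toEquiv

/-- In a nonabelian `p`-group of class two in which the conjugacy class of every noncentral `x` is
`xH'`, one has `|H'| ^ 2 ≤ |H : Z(H)|`. -/
theorem card_commutator_sq_le_index_center {H : Type*} [Group H] [Finite H] {p : ℕ}
    (hp : p.Prime) (hH : IsPGroup p H) (h2 : commutator H ≤ Subgroup.center H)
    (hne : commutator H ≠ ⊥)
    (hsurj : ∀ x ∉ Subgroup.center H, ∀ z ∈ commutator H, ∃ y, ⁅x, y⁆ = z) :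
    Nat.card (commutator H) ^ 2 ≤ (Subgroup.center H).index := by
  have : Fact p.Prime := ⟨hp⟩
  have hker : (commutatorBihom h2).ker = Subgroup.center H := by
    ext x
    exact commutatorBihom_apply_eq_one_iff h2 x
  rw [← card_subgroupOf_center h2]
  refine le_of_le_of_eq (card_sq_le_index_ker ((hH.to_subgroup _).to_subgroup _)
    (commutatorBihom h2) (fun x => ?_) (fun x hx => ?_) fun h => ?_) (congrArg _ hker)
  · ext
    simp [coe_commutatorBihom_apply]
  · rintro ⟨⟨z, hz⟩, hz'⟩
    obtain ⟨y, rfl⟩ := hsurj x (mt (commutatorBihom_apply_eq_one_iff h2 x).mpr hx) z hz'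
    exact ⟨y, rfl⟩
  · apply hne
    rw [commutator_def, Subgroup.commutator_eq_bot_iff_le_centralizer, Subgroup.coe_top,
      Subgroup.centralizer_univ, ← hker, h, MonoidHom.ker_one]

/-- A complex representation that is irreducible and trivial on the derived subgroup has
dimension one. -/
theorem finrank_eq_one_of_commutator_le_ker {H V : Type*} [Group H] [AddCommGroup V] [Module ℂ V]
    [FiniteDimensional ℂ V] (ρ : Representation ℂ H V) (hρ : ρ.IsIrreducible)
    (hker : ∀ z ∈ commutator H, ρ z = 1) : Module.finrank ℂ V = 1 := by
  have hcomm (x y : H) : ρ x * ρ y = ρ y * ρ x := by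
    have h := hker ⁅x, y⁆ (Subgroup.commutator_mem_commutator trivial trivial)
    have hxy : x * y = ⁅x, y⁆ * (y * x) := by simp only [commutatorElement_def]; group
    rw [← map_mul, hxy, map_mul, h, one_mul, map_mul]
  -- The operators commute, so each is a self-intertwiner and Schur's lemma applies; every line is
  -- then invariant.
  have hscalar (x : H) : ∃ c : ℂ, ∀ v, ρ x v = c • v := by
    let f : Representation.IntertwiningMap ρ ρ := ⟨ρ x, fun y => hcomm x y⟩
    obtain ⟨c, hc⟩ :=
      (Representation.IsIrreducible.algebraMap_intertwiningMap_bijective_of_isAlgClosed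
        (ρ := ρ)).2 f
    refine ⟨c, fun v => ?_⟩
    have := DFunLike.congr_fun hc v
    exact this.symm
  have hV : Nontrivial V := by
    by_contra h
    rw [not_nontrivial_iff_subsingleton] at h
    refine (bot_ne_top (α := Subrepresentation ρ)) ?_
    ext v
    rw [Subsingleton.elim v 0]
    simp
  obtain ⟨v, hv⟩ := exists_ne (0 : V)
  let S : Subrepresentation ρ := ⟨Submodule.span ℂ {v}, fun x w hw => by
    obtain ⟨c, hc⟩ := hscalar x
    rw [hc]
    exact Submodule.smul_mem _ _ hw⟩
  have hS : S = ⊤ := by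
    refine (eq_bot_or_eq_top S).resolve_left fun h => hv ?_
    have : v ∈ S := Submodule.mem_span_singleton_self v
    rw [h] at this
    exact this
  have hspan : Submodule.span ℂ {v} = ⊤ := congrArg Subrepresentation.toSubmodule hS
  rw [finrank_eq_one_iff']
  refine ⟨v, hv, fun w => ?_⟩
  have : w ∈ Submodule.span ℂ {v} := hspan ▸ Submodule.mem_top
  exact Submodule.mem_span_singleton.mp this

/-- A group of class two in which the conjugacy class of every noncentral `x` is `xH'` is a
VZ-group. -/
theorem isVZGroup_of_forall_commutator_surjective {H : Type*} [Group H]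
    (h2 : commutator H ≤ Subgroup.center H)
    (hsurj : ∀ x ∉ Subgroup.center H, ∀ z ∈ commutator H, ∃ y, ⁅x, y⁆ = z) : IsVZGroup H := by
  rintro χ ⟨n, ρ, hρ, rfl⟩ hχ x hx
  obtain ⟨z, hz, hz1⟩ : ∃ z ∈ commutator H, ρ z ≠ 1 := by
    by_contra! h
    apply hχ
    rw [Representation.char_one, finrank_eq_one_of_commutator_le_ker ρ hρ h, Nat.cast_one]
  let f : Representation.IntertwiningMap ρ ρ := ⟨ρ z, fun y => by
    change ρ z * ρ y = ρ y * ρ z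
    rw [← map_mul, ← map_mul, Subgroup.mem_center_iff.mp (h2 hz) y]⟩
  obtain ⟨c, hc⟩ :=
    (Representation.IsIrreducible.algebraMap_intertwiningMap_bijective_of_isAlgClosed
      (ρ := ρ)).2 f
  have hc' : ρ z = c • 1 := LinearMap.ext fun v => (DFunLike.congr_fun hc v).symm
  have hc1 : c ≠ 1 := by
    rintro rfl
    exact hz1 (by rw [hc', one_smul])
  -- This makes x conjugate to zx. As z acts by the scalar c ≠ 1, χ(x) = cχ(x).
  obtain ⟨y, hy⟩ := hsurj x hx z⁻¹ (inv_mem hz)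
  have hconj : y * x * y⁻¹ = z * x := by
    have h1 : y * x * y⁻¹ = ⁅x, y⁆⁻¹ * x := by simp only [commutatorElement_def]; group
    rw [h1, hy, inv_inv]
  have h := ρ.char_conj x y
  rw [hconj, Representation.character, map_mul, hc', smul_mul_assoc, one_mul, map_smul,
    smul_eq_mul] at h
  have h' : (c - 1) * ρ.character x = 0 := by
    rw [sub_mul, one_mul, sub_eq_zero]
    exact h
  exact (mul_eq_zero.mp h').resolve_left (sub_ne_zero.mpr hc1)

/-! ### Duality for pairings into ℂˣ -/

/-- The left radical of a pairing of finite groups into `ℂˣ` has index at most that of the right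
radical. -/
theorem index_ker_le_index_ker_flip {A B : Type*} [Group A] [Group B] [Finite A] [Finite B]
    (γ : A →* B →* ℂˣ) : γ.ker.index ≤ γ.flip.ker.index := by
  have : Finite γ.flip.range := Finite.of_surjective _ γ.flip.rangeRestrict_surjective
  -- `A` modulo the left radical embeds in the dual of `B` modulo the right radical, and a finite
  -- abelian group has as many characters as elements.
  let δ : A →* γ.flip.range →* ℂˣ :=
    { toFun := fun a => (MonoidHom.eval a).comp γ.flip.range.subtype
      map_one' := by ext; simp
      map_mul' := fun a b => by ext; simp }
  have hker : δ.ker = γ.ker := by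
    ext a
    simp only [MonoidHom.mem_ker]
    constructor
    · intro h
      ext b
      exact congrArg Units.val (DFunLike.congr_fun h ⟨γ.flip b, b, rfl⟩)
    · intro h
      ext ⟨f, b, hb⟩
      subst hb
      exact congrArg Units.val (DFunLike.congr_fun h b)
  have hfin : Nat.card (γ.flip.range →* ℂˣ) = Nat.card γ.flip.range :=
    CommGroup.card_monoidHom_of_hasEnoughRootsOfUnity _ ℂ
  have : Finite (γ.flip.range →* ℂˣ) :=
    Nat.finite_of_card_ne_zero (hfin ▸ Nat.card_pos.ne')
  rw [← hker, Subgroup.index_ker, Subgroup.index_ker, ← hfin]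
  exact Subgroup.card_le_card_group _

theorem index_ker_eq_index_ker_flip {A B : Type*} [Group A] [Group B] [Finite A] [Finite B]
    (γ : A →* B →* ℂˣ) : γ.ker.index = γ.flip.ker.index :=
  le_antisymm (index_ker_le_index_ker_flip γ) (index_ker_le_index_ker_flip γ.flip)

/-! ### Centralizers modulo a normal subgroup -/

section

variable {G : Type*} [Group G]

/-- The elements of `G` that commute with every element of `S` modulo `N`. -/
def centralizerMod (N : Subgroup G) [N.Normal] (S : Set G) : Subgroup G :=
  (Subgroup.centralizer (QuotientGroup.mk' N '' S)).comap (QuotientGroup.mk' N)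

theorem mk_commutatorElement (N : Subgroup G) [N.Normal] (x y : G) :
    (QuotientGroup.mk' N) ⁅x, y⁆ = ⁅QuotientGroup.mk' N x, QuotientGroup.mk' N y⁆ :=
  map_commutatorElement _ _ _

theorem commutatorElement_mem_iff (N : Subgroup G) [N.Normal] (x y : G) :
    ⁅x, y⁆ ∈ N ↔ QuotientGroup.mk' N x * QuotientGroup.mk' N y =
      QuotientGroup.mk' N y * QuotientGroup.mk' N x := by
  rw [← commutatorElement_eq_one_iff_mul_comm, ← mk_commutatorElement]
  exact (QuotientGroup.eq_one_iff _).symm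

theorem mem_centralizerMod {N : Subgroup G} [N.Normal] {S : Set G} {g : G} :
    g ∈ centralizerMod N S ↔ ∀ x ∈ S, ⁅x, g⁆ ∈ N := by
  simp only [centralizerMod, Subgroup.mem_comap, Subgroup.mem_centralizer_iff,
    Set.forall_mem_image, commutatorElement_mem_iff]

theorem mem_comap_center {N : Subgroup G} [N.Normal] {z : G} :
    z ∈ (Subgroup.center (G ⧸ N)).comap (QuotientGroup.mk' N) ↔ ∀ g, ⁅z, g⁆ ∈ N := by
  simp only [Subgroup.mem_comap, Subgroup.mem_center_iff, commutatorElement_mem_iff]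
  constructor
  · intro h g
    exact (h _).symm
  · intro h q
    obtain ⟨g, rfl⟩ := QuotientGroup.mk'_surjective N q
    exact (h g).symm

theorem commutator_quotient_eq_map (N : Subgroup G) [N.Normal] :
    commutator (G ⧸ N) = (commutator G).map (QuotientGroup.mk' N) := by
  rw [commutator_def, commutator_def, Subgroup.map_commutator,
    Subgroup.map_top_of_surjective _ (QuotientGroup.mk'_surjective N)]

theorem card_commutator_quotient (N : Subgroup G) [N.Normal] :
    Nat.card (commutator (G ⧸ N)) = N.relIndex (commutator G) := by
  rw [commutator_quotient_eq_map, ← Subgroup.relIndex_ker, QuotientGroup.ker_mk']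

theorem commutatorElement_mem_thirdTerm {z : G} (hz : z ∈ commutator G) (g : G) :
    ⁅z, g⁆ ∈ thirdTerm G :=
  Subgroup.commutator_mem_commutator hz trivial

instance thirdTerm_normal : (thirdTerm G).Normal := by
  unfold thirdTerm; infer_instance

theorem thirdTerm_le_commutator : thirdTerm G ≤ commutator G :=
  Subgroup.commutator_mono le_top le_rfl

theorem commutator_quotient_le_center {N : Subgroup G} [N.Normal] (hN : thirdTerm G ≤ N) :
    commutator (G ⧸ N) ≤ Subgroup.center (G ⧸ N) := by
  rw [commutator_quotient_eq_map, Subgroup.map_le_iff_le_comap]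
  intro z hz
  exact mem_comap_center.mpr fun g => hN (commutatorElement_mem_thirdTerm hz g)

/-- If every element of `G'` is a commutator `[x, g]`, then the centralizer of `x` modulo
`N ≥ [G', G]` has index `|G' : N ∩ G'|`. -/
theorem index_centralizerMod_singleton {N : Subgroup G} [N.Normal] (hN : thirdTerm G ≤ N) {x : G}
    (hx : ∀ z ∈ commutator G, ∃ g, ⁅x, g⁆ = z) :
    (centralizerMod N {x}).index = N.relIndex (commutator G) := by
  have h2 := commutator_quotient_le_center hN
  let f := (commutatorBihom h2 (QuotientGroup.mk' N x)).comp (QuotientGroup.mk' N)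
  have hf : Function.Surjective f := by
    rintro ⟨⟨q, hq⟩, hq'⟩
    rw [Subgroup.mem_subgroupOf, commutator_quotient_eq_map] at hq'
    obtain ⟨z, hz, rfl⟩ := hq'
    obtain ⟨g, rfl⟩ := hx z hz
    exact ⟨g, Subtype.ext (Subtype.ext (mk_commutatorElement N x g).symm)⟩
  have hker : f.ker = centralizerMod N {x} := by
    ext g
    rw [mem_centralizerMod, MonoidHom.mem_ker]
    simp only [Set.mem_singleton_iff, forall_eq]
    rw [← QuotientGroup.eq_one_iff]
    change _ ↔ QuotientGroup.mk' N ⁅x, g⁆ = 1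
    rw [mk_commutatorElement, Subtype.ext_iff, Subtype.ext_iff]
    rfl
  rw [← hker, Subgroup.index_ker, MonoidHom.range_eq_top.mpr hf, Subgroup.card_top,
    card_subgroupOf_center h2, card_commutator_quotient]

/-- In a group with `[G', G]` central, the commutator pairing `G' × G → [G', G]` composed with a
character of the center. -/
def commutatorPairing (h3 : thirdTerm G ≤ Subgroup.center G) (lam : Subgroup.center G →* ℂˣ) :
    commutator G →* G →* ℂˣ :=
  MonoidHom.mk'
    (fun z => MonoidHom.mk'
      (fun g => lam ⟨⁅(z : G), g⁆, h3 (commutatorElement_mem_thirdTerm z.2 g)⟩)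
      fun g h => by
        rw [← map_mul]
        congr 1
        refine Subtype.ext ?_
        change ⁅(z : G), g * h⁆ = ⁅(z : G), g⁆ * ⁅(z : G), h⁆
        have hc : g * ⁅(z : G), h⁆ = ⁅(z : G), h⁆ * g :=
          Subgroup.mem_center_iff.mp (h3 (commutatorElement_mem_thirdTerm z.2 h)) g
        rw [show ⁅(z : G), g * h⁆ = ⁅(z : G), g⁆ * (g * ⁅(z : G), h⁆ * g⁻¹) by
          simp only [commutatorElement_def]; group, hc, mul_inv_cancel_right])
    fun z w => by
      refine MonoidHom.ext fun g => ?_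
      rw [MonoidHom.mul_apply]
      change lam _ = lam _ * lam _
      rw [← map_mul]
      congr 1
      refine Subtype.ext ?_
      change ⁅(z : G) * w, g⁆ = ⁅(z : G), g⁆ * ⁅(w : G), g⁆
      have hc : ∀ a, a * ⁅(w : G), g⁆ = ⁅(w : G), g⁆ * a :=
        Subgroup.mem_center_iff.mp (h3 (commutatorElement_mem_thirdTerm w.2 g))
      rw [show ⁅(z : G) * w, g⁆ = (z * ⁅(w : G), g⁆ * (z : G)⁻¹) * ⁅(z : G), g⁆ by
        simp only [commutatorElement_def]; group, hc z, mul_inv_cancel_right, hc]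

/-- The kernel of a character of the center, as a subgroup of the whole group. -/
def centralCharKer (lam : Subgroup.center G →* ℂˣ) : Subgroup G :=
  lam.ker.map (Subgroup.center G).subtype

instance centralCharKer_normal (lam : Subgroup.center G →* ℂˣ) : (centralCharKer lam).Normal := by
  refine ⟨?_⟩
  rintro _ ⟨c, hc, rfl⟩ g
  refine ⟨c, hc, ?_⟩
  have := Subgroup.mem_center_iff.mp c.2 g
  rw [Subgroup.subtype_apply, this, mul_inv_cancel_right]

theorem mem_centralCharKer {lam : Subgroup.center G →* ℂˣ} {c : G} (hc : c ∈ Subgroup.center G) :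
    c ∈ centralCharKer lam ↔ lam ⟨c, hc⟩ = 1 := by
  constructor
  · rintro ⟨d, hd, rfl⟩
    exact hd
  · intro h
    exact ⟨⟨c, hc⟩, h, rfl⟩

/-- Duality between `G / C_G(G' mod ker λ)` and `G' / (G' ∩ Z(G mod ker λ))`. -/
theorem index_centralizerMod_commutator [Finite G] (h3 : thirdTerm G ≤ Subgroup.center G)
    (lam : Subgroup.center G →* ℂˣ) :
    (centralizerMod (centralCharKer lam) (commutator G : Set G)).index =
      (commutator G ⊓ (Subgroup.center (G ⧸ centralCharKer lam)).comap
        (QuotientGroup.mk' (centralCharKer lam))).relIndex (commutator G) := by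
  have key (z : commutator G) (g : G) :
      commutatorPairing h3 lam z g = 1 ↔ ⁅(z : G), g⁆ ∈ centralCharKer lam :=
    (mem_centralCharKer (h3 (commutatorElement_mem_thirdTerm z.2 g))).symm
  have h1 : (commutatorPairing h3 lam).flip.ker =
      centralizerMod (centralCharKer lam) (commutator G : Set G) := by
    ext g
    rw [mem_centralizerMod, MonoidHom.mem_ker, DFunLike.ext_iff]
    exact ⟨fun h x hx => (key ⟨x, hx⟩ g).mp (h _), fun h z => (key z g).mpr (h z z.2)⟩
  have h2 : (commutatorPairing h3 lam).ker =
      (commutator G ⊓ (Subgroup.center (G ⧸ centralCharKer lam)).comap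
        (QuotientGroup.mk' (centralCharKer lam))).subgroupOf (commutator G) := by
    ext z
    rw [Subgroup.mem_subgroupOf, Subgroup.mem_inf, mem_comap_center, MonoidHom.mem_ker,
      DFunLike.ext_iff]
    exact ⟨fun h => ⟨z.2, fun g => (key z g).mp (h g)⟩, fun h g => (key z g).mpr (h.2 g)⟩
  rw [← h1, ← index_ker_eq_index_ker_flip, h2]
  rfl

/-! ### Camina groups and the index sandwich -/

/-- In a Camina group every element of `G'` is a commutator `[x, g]`, for each `x ∉ G'`. -/
theorem IsCaminaGroup.exists_commutatorElement_eq (h : IsCaminaGroup G) {x : G}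
    (hx : x ∉ commutator G) {z : G} (hz : z ∈ commutator G) : ∃ g, ⁅x, g⁆ = z := by
  -- [x, g] = z means gxg⁻¹ = z⁻¹x, which is x times this element.
  have hw : x⁻¹ * z⁻¹ * x ∈ commutator G := by
    have hn : (commutator G).Normal := inferInstance
    simpa using hn.conj_mem _ (inv_mem hz) x⁻¹
  have hmem : x * (x⁻¹ * z⁻¹ * x) ∈ conjugatesOf x := by
    rw [h x hx]
    exact Set.smul_mem_smul_set hw
  obtain ⟨g, hg⟩ := isConj_iff.mp hmem
  refine ⟨g, ?_⟩
  rw [show ⁅x, g⁆ = x * (g * x * g⁻¹)⁻¹ by simp only [commutatorElement_def]; group, hg]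
  group

theorem thirdTerm_eq_bot_of_commutator_le_center (h : commutator G ≤ Subgroup.center G) :
    thirdTerm G = ⊥ := by
  rw [thirdTerm, Subgroup.commutator_eq_bot_iff_le_centralizer, Subgroup.coe_top,
    Subgroup.centralizer_univ]
  exact h

theorem subgroup_eq_of_le_of_index_eq [Finite G] {H K : Subgroup G} (hle : H ≤ K)
    (h : H.index = K.index) : H = K := by
  have h1 := Subgroup.relIndex_mul_index hle
  rw [h] at h1
  have h2 : H.relIndex K = 1 :=
    Nat.eq_of_mul_eq_mul_right (Nat.pos_of_ne_zero K.index_ne_zero_of_finite) (by rw [h1, one_mul])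
  exact le_antisymm hle (Subgroup.relIndex_eq_one.mp h2)

/-- In a Camina `p`-group with `[G', G]` nontrivial and central, `|G' : G₃| ^ 2 ≤ |G : G'|`. -/
theorem IsCaminaGroup.relIndex_sq_le_index [Finite G] {p : ℕ} (hp : p.Prime) (hG : IsPGroup p G)
    (h : IsCaminaGroup G) (h3 : thirdTerm G ≤ Subgroup.center G) (hne : thirdTerm G ≠ ⊥) :
    (thirdTerm G).relIndex (commutator G) ^ 2 ≤ (commutator G).index := by
  have hlt : ¬ commutator G ≤ thirdTerm G := fun hle =>
    hne (thirdTerm_eq_bot_of_commutator_le_center (hle.trans h3))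
  -- For x ∉ G' the commutators [x, g] fill G', which is not contained in G₃, so x is not central
  -- modulo G₃.
  have hcomap : (Subgroup.center (G ⧸ thirdTerm G)).comap (QuotientGroup.mk' (thirdTerm G)) =
      commutator G := by
    ext x
    rw [mem_comap_center]
    refine ⟨fun hx => ?_, fun hx g => commutatorElement_mem_thirdTerm hx g⟩
    by_contra hx'
    refine hlt fun z hz => ?_
    obtain ⟨g, rfl⟩ := h.exists_commutatorElement_eq hx' hz
    exact hx g
  have hindex : (Subgroup.center (G ⧸ thirdTerm G)).index = (commutator G).index := by
    rw [← hcomap, Subgroup.index_comap_of_surjective _ (QuotientGroup.mk'_surjective _)]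
  rw [← card_commutator_quotient, ← hindex]
  refine card_commutator_sq_le_index_center hp (hG.to_quotient _)
    (commutator_quotient_le_center le_rfl) (fun hbot => hlt ?_) ?_
  · rw [commutator_quotient_eq_map, Subgroup.map_eq_bot_iff, QuotientGroup.ker_mk'] at hbot
    exact hbot
  · intro q hq z hz
    obtain ⟨x, rfl⟩ := QuotientGroup.mk'_surjective _ q
    rw [commutator_quotient_eq_map] at hz
    obtain ⟨z, hz, rfl⟩ := hz
    have hx : x ∉ commutator G := by
      rw [← hcomap]
      exact hq
    obtain ⟨g, rfl⟩ := h.exists_commutatorElement_eq hx hz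
    exact ⟨QuotientGroup.mk' _ g, (mk_commutatorElement _ x g).symm⟩

/-- Two elements that centralize `G'` modulo `N` have a commutator that is central modulo `N`. -/
theorem commutatorElement_mem_comap_center {N : Subgroup G} [N.Normal] {x y : G}
    (hx : x ∈ centralizerMod N (commutator G : Set G))
    (hy : y ∈ centralizerMod N (commutator G : Set G)) :
    ⁅x, y⁆ ∈ (Subgroup.center (G ⧸ N)).comap (QuotientGroup.mk' N) := by
  rw [centralizerMod, ← Subgroup.coe_map, ← commutator_quotient_eq_map] at hx hy
  rw [Subgroup.mem_comap, mk_commutatorElement]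
  -- An instance of the three subgroups lemma in G/N.
  exact commutator_centralizer_commutator_le_center _ (Subgroup.commutator_mem_commutator hx hy)

/-- If every `x ∈ D` that commutes with a fixed `g` modulo `Z ≥ G₃` lies in `G'`, then
`|D : G'| ≤ |G' : Z|`. -/
theorem relIndex_commutator_le_relIndex [Finite G] {Z D : Subgroup G} [Z.Normal]
    (hZ : thirdTerm G ≤ Z) (g : G) (hg : ∀ x ∈ D, ⁅x, g⁆ ∈ Z → x ∈ commutator G) :
    (commutator G).relIndex D ≤ Z.relIndex (commutator G) := by
  have h2 := commutator_quotient_le_center hZ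
  let f := (((commutatorBihom h2).flip (QuotientGroup.mk' Z g)).comp (QuotientGroup.mk' Z)).comp
    D.subtype
  have hker : f.ker ≤ (commutator G).subgroupOf D := by
    intro x hx
    have hx1 : f x = 1 := hx
    refine hg x x.2 ((QuotientGroup.eq_one_iff _).mp ?_)
    change QuotientGroup.mk' Z ⁅(x : G), g⁆ = 1
    rw [mk_commutatorElement]
    exact congrArg Subtype.val (congrArg Subtype.val hx1)
  calc (commutator G).relIndex D ≤ f.ker.index := Subgroup.index_antitone hker
    _ = Nat.card f.range := Subgroup.index_ker f
    _ ≤ _ := Subgroup.card_le_card_group _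
    _ = Z.relIndex (commutator G) := by
      rw [card_subgroupOf_center h2, card_commutator_quotient]

/-- The centralizer of `G'` modulo the kernel of a character of the center that is nontrivial on
`G₃`, in a Camina `p`-group of class three: its index is `|G' : G₃|`, it is the centralizer modulo
`G₃` of each of its elements outside `G'`, and `|G : G'| = |G' : G₃| ^ 2`. -/
theorem IsCaminaGroup.centralizerMod_centralCharKer [Finite G] {p : ℕ} (hp : p.Prime)
    (hG : IsPGroup p G) (h : IsCaminaGroup G) (h3 : thirdTerm G ≤ Subgroup.center G)
    (lam : Subgroup.center G →* ℂˣ) (hlam : ¬ thirdTerm G ≤ centralCharKer lam) :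
    (centralizerMod (centralCharKer lam) (commutator G : Set G)).index =
        (thirdTerm G).relIndex (commutator G) ∧
      (commutator G).index = (thirdTerm G).relIndex (commutator G) ^ 2 ∧
      ∀ x ∈ centralizerMod (centralCharKer lam) (commutator G : Set G), x ∉ commutator G →
        centralizerMod (centralCharKer lam) (commutator G : Set G) =
          centralizerMod (thirdTerm G) {x} := by
  set N := centralCharKer lam with hN
  set D := centralizerMod N (commutator G : Set G) with hD
  set Z := commutator G ⊓ (Subgroup.center (G ⧸ N)).comap (QuotientGroup.mk' N) with hZdef
  have hZn : Z.Normal := by rw [hZdef]; infer_instance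
  have hZle : Z ≤ commutator G := inf_le_left
  have h3Z : thirdTerm G ≤ Z := by
    refine le_inf thirdTerm_le_commutator fun t ht => mem_comap_center.mpr fun g => ?_
    rw [commutatorElement_eq_one_iff_mul_comm.mpr (Subgroup.mem_center_iff.mp (h3 ht) g).symm]
    exact one_mem N
  have hGD : commutator G ≤ D := by
    intro z hz
    refine mem_centralizerMod.mpr fun w hw => ?_
    have hcz : w * z = z * w := by
      -- Three subgroups again: class three makes G' abelian.
      have h1 : ⁅commutator G, commutator G⁆ = ⊥ := by
        have h4 : ⁅⁅commutator G, (⊤ : Subgroup G)⁆, (⊤ : Subgroup G)⁆ = ⊥ := by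
          rw [Subgroup.commutator_eq_bot_iff_le_centralizer, Subgroup.coe_top,
            Subgroup.centralizer_univ]
          exact h3
        rw [Subgroup.commutator_comm]
        nth_rewrite 1 [commutator_def]
        refine Subgroup.commutator_commutator_eq_bot_of_rotate ?_ h4
        rwa [Subgroup.commutator_comm ⊤]
      exact commutatorElement_eq_one_iff_mul_comm.mp
        ((Subgroup.mem_bot).mp (h1 ▸ Subgroup.commutator_mem_commutator hw hz))
    rw [commutatorElement_eq_one_iff_mul_comm.mpr hcz]
    exact one_mem N
  have hDindex : D.index = Z.relIndex (commutator G) := index_centralizerMod_commutator h3 lam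
  -- One inclusion plus equal indices: duality computes one, the Camina condition the other.
  have hDx : ∀ x ∈ D, x ∉ commutator G → D = centralizerMod Z {x} := by
    intro x hx hx'
    refine subgroup_eq_of_le_of_index_eq (fun y hy => ?_) ?_
    · rw [mem_centralizerMod]
      rintro _ rfl
      exact ⟨Subgroup.commutator_mem_commutator trivial trivial,
        commutatorElement_mem_comap_center hx hy⟩
    · rw [hDindex, index_centralizerMod_singleton h3Z
        fun z hz => h.exists_commutatorElement_eq hx' hz]
  obtain ⟨g, hg⟩ : ∃ g, g ∉ D := by
    by_contra! hall
    refine hlam (Subgroup.commutator_le.mpr fun z hz g _ => ?_)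
    exact mem_centralizerMod.mp (hall g) z hz
  have hrel : (commutator G).relIndex D ≤ Z.relIndex (commutator G) := by
    refine relIndex_commutator_le_relIndex h3Z g fun x hx hxg => ?_
    by_contra hx'
    refine hg ?_
    rw [hDx x hx hx', mem_centralizerMod]
    rintro _ rfl
    exact hxg
  have hsq : (thirdTerm G).relIndex (commutator G) ^ 2 ≤ (commutator G).index :=
    h.relIndex_sq_le_index hp hG h3 fun h0 => hlam (h0 ▸ bot_le)
  have hmul : (commutator G).relIndex D * D.index = (commutator G).index :=
    Subgroup.relIndex_mul_index hGD
  have hmul' : (thirdTerm G).relIndex Z * Z.relIndex (commutator G) =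
      (thirdTerm G).relIndex (commutator G) := Subgroup.relIndex_mul_relIndex _ _ _ h3Z hZle
  have hpos : 0 < Z.relIndex (commutator G) :=
    Nat.pos_of_ne_zero (Subgroup.index_ne_zero_of_finite)
  have hpos' : 0 < (thirdTerm G).relIndex Z :=
    Nat.pos_of_ne_zero (Subgroup.index_ne_zero_of_finite)
  have hle : (commutator G).index ≤ Z.relIndex (commutator G) ^ 2 := by
    rw [← hmul, hDindex, sq]
    exact Nat.mul_le_mul_right _ hrel
  have hle' : (thirdTerm G).relIndex (commutator G) ≤ Z.relIndex (commutator G) :=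
    (Nat.pow_le_pow_iff_left two_ne_zero).mp (hsq.trans hle)
  -- |G' : G₃| = |Z : G₃| |G' : Z| is at most |G' : Z|, which leaves no room between G₃ and Z.
  have hone : (thirdTerm G).relIndex Z = 1 := by
    by_contra hne
    have h2 : 2 ≤ (thirdTerm G).relIndex Z := by omega
    have := Nat.mul_le_mul_right (Z.relIndex (commutator G)) h2
    omega
  have hZ3 : Z = thirdTerm G := le_antisymm (Subgroup.relIndex_eq_one.mp hone) h3Z
  have hEq : Z.relIndex (commutator G) = (thirdTerm G).relIndex (commutator G) := by rw [hZ3]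
  refine ⟨hDindex.trans hEq, le_antisymm (hEq ▸ hle) hsq, fun x hx hx' => ?_⟩
  rw [hDx x hx hx']
  ext y
  rw [mem_centralizerMod, mem_centralizerMod, hZ3]

/-- A character of the center of a finite group that is nontrivial at a given element. -/
theorem exists_notMem_centralCharKer [Finite G] {t : G} (ht : t ∈ Subgroup.center G)
    (ht1 : t ≠ 1) : ∃ lam : Subgroup.center G →* ℂˣ, t ∉ centralCharKer lam := by
  obtain ⟨lam, hlam⟩ := CommGroup.exists_apply_ne_one_of_hasEnoughRootsOfUnity
    (Subgroup.center G) ℂ (a := ⟨t, ht⟩) (fun h => ht1 (congrArg Subtype.val h))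
  exact ⟨lam, fun h => hlam ((mem_centralCharKer ht).mp h)⟩

theorem centralizer_le_centralizerMod (N : Subgroup G) [N.Normal] (S : Set G) :
    Subgroup.centralizer S ≤ centralizerMod N S := by
  intro g hg
  refine mem_centralizerMod.mpr fun x hx => ?_
  rw [commutatorElement_eq_one_iff_mul_comm.mpr (Subgroup.mem_centralizer_iff.mp hg x hx)]
  exact one_mem N

/-- In a Camina `p`-group of class three, `C_G(G')` is the centralizer modulo `G₃` of each of its
elements outside `G'`. -/
theorem IsCaminaGroup.mem_centralizer_commutator_iff [Finite G] {p : ℕ} (hp : p.Prime)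
    (hG : IsPGroup p G) (h : IsCaminaGroup G) (h3 : thirdTerm G ≤ Subgroup.center G)
    (hne : thirdTerm G ≠ ⊥) {x : G} (hx : x ∈ Subgroup.centralizer (commutator G : Set G))
    (hx' : x ∉ commutator G) (g : G) :
    g ∈ Subgroup.centralizer (commutator G : Set G) ↔ ⁅x, g⁆ ∈ thirdTerm G := by
  -- The right-hand side does not mention λ, so any λ nontrivial on G₃ may be chosen below, in
  -- particular one detecting a given nontrivial [z, g].
  have key (lam : Subgroup.center G →* ℂˣ) (hlam : ¬ thirdTerm G ≤ centralCharKer lam) :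
      g ∈ centralizerMod (centralCharKer lam) (commutator G : Set G) ↔ ⁅x, g⁆ ∈ thirdTerm G := by
    rw [(h.centralizerMod_centralCharKer hp hG h3 lam hlam).2.2 x
      (centralizer_le_centralizerMod _ _ hx) hx', mem_centralizerMod]
    simp
  constructor
  · intro hg
    obtain ⟨t, ht1⟩ := Subgroup.ne_bot_iff_exists_ne_one.mp hne
    obtain ⟨lam, hlam⟩ := exists_notMem_centralCharKer (h3 t.2) fun h1 => ht1 (Subtype.ext h1)
    exact (key lam fun hle => hlam (hle t.2)).mp (centralizer_le_centralizerMod _ _ hg)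
  · intro hg
    refine Subgroup.mem_centralizer_iff.mpr fun z hz => ?_
    by_contra hzg
    have ht := commutatorElement_mem_thirdTerm hz g
    obtain ⟨lam, hlam⟩ := exists_notMem_centralCharKer (h3 ht)
      (mt commutatorElement_eq_one_iff_mul_comm.mp hzg)
    exact hlam (mem_centralizerMod.mp ((key lam fun hle => hlam (hle ht)).mpr hg) z hz)

/-- In a Camina `p`-group of class three with `C = C_G(G') > G'`, `|C : G'| = |G' : G₃|`. -/
theorem IsCaminaGroup.relIndex_centralizer_commutator [Finite G] {p : ℕ} (hp : p.Prime)
    (hG : IsPGroup p G) (h : IsCaminaGroup G) (h3 : thirdTerm G ≤ Subgroup.center G)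
    (hne : thirdTerm G ≠ ⊥) (hlt : commutator G < Subgroup.centralizer (commutator G : Set G)) :
    (commutator G).relIndex (Subgroup.centralizer (commutator G : Set G)) =
      (thirdTerm G).relIndex (commutator G) := by
  obtain ⟨x, hx, hx'⟩ := SetLike.exists_of_lt hlt
  obtain ⟨t, ht1⟩ := Subgroup.ne_bot_iff_exists_ne_one.mp hne
  obtain ⟨lam, hlam⟩ := exists_notMem_centralCharKer (h3 t.2) fun h1 => ht1 (Subtype.ext h1)
  obtain ⟨-, hidx, -⟩ :=
    h.centralizerMod_centralCharKer hp hG h3 lam fun hle => hlam (hle t.2)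
  have hC : Subgroup.centralizer (commutator G : Set G) = centralizerMod (thirdTerm G) {x} := by
    ext g
    rw [h.mem_centralizer_commutator_iff hp hG h3 hne hx hx', mem_centralizerMod]
    simp
  have hCi : (Subgroup.centralizer (commutator G : Set G)).index =
      (thirdTerm G).relIndex (commutator G) := by
    rw [hC, index_centralizerMod_singleton le_rfl
      fun z hz => h.exists_commutatorElement_eq hx' hz]
  have hmul := Subgroup.relIndex_mul_index hlt.le
  rw [hCi, hidx, sq] at hmul
  exact Nat.eq_of_mul_eq_mul_right (Nat.pos_of_ne_zero Subgroup.index_ne_zero_of_finite) hmul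

end

/-! ### The structure of C -/

theorem theorem3p9 {G : Type*} [Group G] [Finite G] [Group.IsNilpotent G]
    (p : ℕ) (hp : p.Prime) (hpG : IsPGroup p G)
    (hCamina : IsCaminaGroup G)
    (hclass : Group.nilpotencyClass G = 3)
    (C : Subgroup G) (hC : C = Subgroup.centralizer (commutator G : Set G))
    (hlt : commutator G < C) :
    ((commutator C).map C.subtype = thirdTerm G ∧
      (Subgroup.center C).map C.subtype = commutator G) ∧
    IsVZGroup C ∧
    (Nat.card (thirdTerm G) : ℝ) ≤
      (((thirdTerm G).relIndex (commutator G) : ℕ) : ℝ) ^ ((1 : ℝ) / 2) := by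
  have h3 : thirdTerm G ≤ Subgroup.center G := by
    -- The series is indexed from 0, so term 2 is G₃ and term 3 is [G₃, G].
    have h4 : (⊤ : Subgroup G).lowerCentralSeries 3 = ⊥ :=
      Subgroup.lowerCentralSeries_eq_bot_iff_nilpotencyClass_le.mpr hclass.le
    change ⁅thirdTerm G, (⊤ : Subgroup G)⁆ = ⊥ at h4
    rwa [Subgroup.commutator_eq_bot_iff_le_centralizer, Subgroup.coe_top,
      Subgroup.centralizer_univ] at h4
  have hne : thirdTerm G ≠ ⊥ := by
    intro h0
    have : (⊤ : Subgroup G).lowerCentralSeries 2 = ⊥ := h0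
    have := Subgroup.lowerCentralSeries_eq_bot_iff_nilpotencyClass_le.mp this
    omega
  have hmem : ∀ x ∈ C, x ∉ commutator G → ∀ g, g ∈ C ↔ ⁅x, g⁆ ∈ thirdTerm G := by
    subst hC
    exact fun x hx hx' g => hCamina.mem_centralizer_commutator_iff hp hpG h3 hne hx hx' g
  have hcomm : ∀ z ∈ commutator G, ∀ x ∈ C, z * x = x * z := by
    subst hC
    exact fun z hz x hx => Subgroup.mem_centralizer_iff.mp hx z hz
  have hrel : (commutator G).relIndex C = (thirdTerm G).relIndex (commutator G) := by
    subst hC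
    exact hCamina.relIndex_centralizer_commutator hp hpG h3 hne hlt
  -- A solution g in G of [x, g] = t ∈ G₃ lies in C automatically, since C is the centralizer of x
  -- modulo G₃.
  have hsurj : ∀ x ∈ C, x ∉ commutator G → ∀ t ∈ thirdTerm G, ∃ g ∈ C, ⁅x, g⁆ = t := by
    intro x hx hx' t ht
    obtain ⟨g, rfl⟩ := hCamina.exists_commutatorElement_eq hx' (thirdTerm_le_commutator ht)
    exact ⟨g, (hmem x hx hx' g).mpr ht, rfl⟩
  have hderived : (commutator C).map C.subtype = thirdTerm G := by
    rw [Subgroup.map_subtype_commutator]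
    refine le_antisymm (Subgroup.commutator_le.mpr fun x hx y hy => ?_) fun t ht => ?_
    · by_cases hx' : x ∈ commutator G
      · rw [commutatorElement_eq_one_iff_mul_comm.mpr (hcomm x hx' y hy)]
        exact one_mem _
      · exact (hmem x hx hx' y).mp hy
    · obtain ⟨x, hx, hx'⟩ := SetLike.exists_of_lt hlt
      obtain ⟨g, hg, rfl⟩ := hsurj x hx hx' t ht
      exact Subgroup.commutator_mem_commutator hx hg
  have hcenter : Subgroup.center C = (commutator G).subgroupOf C := by
    ext x
    rw [Subgroup.mem_subgroupOf, Subgroup.mem_center_iff]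
    constructor
    · intro hx
      by_contra hx'
      obtain ⟨t, ht1⟩ := Subgroup.ne_bot_iff_exists_ne_one.mp hne
      obtain ⟨g, hg, hgt⟩ := hsurj x x.2 hx' t t.2
      refine ht1 (Subtype.ext ?_)
      rw [← hgt, Subgroup.coe_one, commutatorElement_eq_one_iff_mul_comm]
      exact congrArg Subtype.val (hx ⟨g, hg⟩).symm
    · intro hx y
      exact Subtype.ext (hcomm x hx y y.2).symm
  have hcenter' : (Subgroup.center C).map C.subtype = commutator G := by
    rw [hcenter, Subgroup.subgroupOf_map_subtype, inf_eq_left]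
    exact hlt.le
  have h2 : commutator C ≤ Subgroup.center C := by
    rw [← Subgroup.map_le_map_iff_of_injective C.subtype_injective, hderived, hcenter']
    exact thirdTerm_le_commutator
  have hsurjC : ∀ x ∉ Subgroup.center C, ∀ z ∈ commutator C, ∃ y, ⁅x, y⁆ = z := by
    intro x hx z hz
    rw [hcenter, Subgroup.mem_subgroupOf] at hx
    obtain ⟨g, hg, hgz⟩ := hsurj x x.2 hx z (hderived ▸ Subgroup.mem_map_of_mem C.subtype hz)
    exact ⟨⟨g, hg⟩, Subtype.ext hgz⟩
  refine ⟨⟨hderived, hcenter'⟩, isVZGroup_of_forall_commutator_surjective h2 hsurjC, ?_⟩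
  have hneC : commutator C ≠ ⊥ := by
    intro h0
    rw [h0, Subgroup.map_bot] at hderived
    exact hne hderived.symm
  have hcard := card_commutator_sq_le_index_center hp (hpG.to_subgroup C) h2 hneC hsurjC
  have hcard3 : Nat.card (commutator C) = Nat.card (thirdTerm G) := by
    rw [← hderived]
    exact (Nat.card_congr ((commutator C).equivMapOfInjective _ C.subtype_injective).toEquiv)
  -- The class-two bound for C becomes |G₃|² ≤ |C : G'| = |G' : G₃|.
  rw [hcard3, hcenter] at hcard
  change _ ≤ (commutator G).relIndex C at hcard
  rw [hrel] at hcard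
  rw [← Real.sqrt_eq_rpow]
  exact Real.le_sqrt_of_sq_le (by exact_mod_cast hcard)
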